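/- **Conventions.** Let $\mathrm{Lin}$ be the category of linearly ordered sets and order preserving injective maps, and let $\mathcal K$ be an accessible category with all directed colimits. For a regular cardinal $\mu$, an object $X$ is $\mu$-presentable if $\mathrm{Hom}(X,-)$ preserves $\mu$-directed colimits. The size $|X|$ of an object $X$ is the least infinite cardinal $\lambda$ such that $X$ is $\lambda^+$-presentable. Let $E:\mathrm{Lin}\to\mathcal K$ be an EM-functor, i.e. a faithful functor preserving directed colimits, and let $\lambda_E$ be the least infinite cardinal such that for every regular $\mu\ge\lambda_E$ the functor $E$ takes $\mu$-presentable objects to $\mu$-presentable objects. Given $M_0\to\bar M\to M$, the object $\bar M$ is *$\mu$-universal over $M_0$ in $M$* if for every factorization $M_0\to N\to M$ of the same composite with $N$ $\mu$-presentable there is a morphism $N\to\bar M$ whose composite with $M_0\to N$ is the given morphism $M_0\to\bar M$. An object $M$ is *brimful at $\mu$* if every morphism $M_0\to M$ with $M_0$ $\mu$-presentable factors as $M_0\to\bar M\to M$ with $\bar M$ $\mu$-presentable and $\mu$-universal over $M_0$ in $M$. An object $M$ is *brimful* if it is brimful at every $\mu=\sigma^+\le|M|$ with $\sigma$ an infinite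 cardinal. **Proposition 7.7.** Let $I$ be a linear order. If $I$ is brimful, then $E(I)$ is brimful from $\lambda_E$ on, that is, $E(I)$ is brimful at every $\mu=\sigma^+$ with $\sigma$ an infinite cardinal and $\lambda_E\le\mu\le|E(I)|$. Moreover, for each regular cardinal $\mu\ge\lambda_E$: if $I$ is brimful at $\mu$, then $E(I)$ is brimful at $\mu$. -/

import Mathlib

universe w v u

open CategoryTheory CategoryTheory.Limits

namespace EM

/-- A linearly ordered set, as an object of the category `Lin`. -/
structure Lin : Type (w + 1) where
  /-- The underlying set. -/
  carrier : Type w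
  /-- The linear order. -/
  [order : LinearOrder carrier]

attribute [instance] Lin.order

/-- The category of linearly ordered sets and order preserving injective maps
(between linear orders these are exactly the order embeddings). -/
instance : Category.{w} Lin.{w} where
  Hom I J := I.carrier ↪o J.carrier
  id I := RelEmbedding.refl _
  comp f g := f.trans g

section

variable {C : Type u} [Category.{v} C]

/-- `X` is `μ`-presentable: `μ` is a regular cardinal and `Hom(X, -)` preserves
`μ`-filtered colimits (equivalently, `μ`-directed colimits). -/
def Presentable (μ : Cardinal.{w}) (X : C) : Prop :=
  ∃ h : μ.IsRegular, haveI : Fact μ.IsRegular := ⟨h⟩; IsCardinalPresentable X μ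

/-- The size of an object: the least infinite cardinal `lam` such that `X` is
`lam⁺`-presentable.  If the presentability rank of `X` is the successor `lam⁺` of an infinite
cardinal `lam`, this is `lam`. (In an accessible category with directed colimits, all objects
that are not finitely presentable are of this kind; the finitely presentable ones get
size `ℵ₀`.) -/
noncomputable def size (X : C) : Cardinal.{w} :=
  sInf {lam : Cardinal.{w} | Cardinal.aleph0 ≤ lam ∧ Presentable (Order.succ lam) X}

/-- For `f₁ : M₀ ⟶ Mbar` and `f₂ : Mbar ⟶ M`: the object `Mbar` is `μ`-universal over `M₀` in `M`,
i.e. for any other factorization of the composite `M₀ ⟶ M` through a `μ`-presentable `N`,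
there is a morphism `N ⟶ Mbar` under `M₀` (no compatibility with the maps to `M` is asked). -/
def IsUniversalOver (μ : Cardinal.{w}) {M₀ Mbar M : C} (f₁ : M₀ ⟶ Mbar) (f₂ : Mbar ⟶ M) : Prop :=
  ∀ (N : C) (b₁ : M₀ ⟶ N) (b₂ : N ⟶ M), Presentable μ N → b₁ ≫ b₂ = f₁ ≫ f₂ →
    ∃ g : N ⟶ Mbar, b₁ ≫ g = f₁

/-- Brimfulness of `M` at one regular cardinal `μ`: every morphism to `M` from a `μ`-presentable
object `M₀` factors through a `μ`-presentable object that is `μ`-universal over `M₀` in `M`. -/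
def IsBrimfulAt (μ : Cardinal.{w}) (M : C) : Prop :=
  ∀ (M₀ : C) (f : M₀ ⟶ M), Presentable μ M₀ →
    ∃ (Mbar : C) (f₁ : M₀ ⟶ Mbar) (f₂ : Mbar ⟶ M),
      Presentable μ Mbar ∧ f₁ ≫ f₂ = f ∧ IsUniversalOver μ f₁ f₂

/-- Brimfulness of `M` at all cardinals `μ = σ⁺` with `σ` infinite and `κ ≤ μ ≤ |M|`. -/
def IsBrimfulFrom (κ : Cardinal.{w}) (M : C) : Prop :=
  ∀ σ : Cardinal.{w}, Cardinal.aleph0 ≤ σ → κ ≤ Order.succ σ → Order.succ σ ≤ size M →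
    IsBrimfulAt (Order.succ σ) M

/-- `M` is brimful: it is brimful at all cardinals `μ = σ⁺ ≤ |M|` with `σ` infinite,
that is, with respect to the objects of size at most `σ`, for all infinite `σ < |M|`. -/
def IsBrimful (M : C) : Prop := IsBrimfulFrom.{w} Cardinal.aleph0 M

/-- The cardinal from which on `E` preserves presentability: the least infinite cardinal `κ` such
that, for all regular `μ ≥ κ`, `E` takes `μ`-presentable linear orders to
`μ`-presentable objects. -/
noncomputable def threshold (E : Lin.{w} ⥤ C) : Cardinal.{w} :=
  sInf {κ : Cardinal.{w} | Cardinal.aleph0 ≤ κ ∧ ∀ μ : Cardinal.{w}, μ.IsRegular → κ ≤ μ →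
    ∀ I : Lin.{w}, Presentable μ I → Presentable μ (E.obj I)}

/-- An EM-functor: a faithful functor from `Lin` preserving directed (equivalently, filtered)
colimits. -/
structure IsEMFunctor (E : Lin.{w} ⥤ C) : Prop where
  faithful : E.Faithful
  preserves : PreservesFilteredColimitsOfSize.{w, w} E

end

end EM

/-! The `μ`-presentable linear orders are those of cardinality below `μ`, and every `I` is the
`μ`-directed colimit of its subsets of this kind, a colimit that `E` preserves. So a map from a
`μ`-presentable `M₀` to `E(I)` factors through `E(S)` with `S ⊆ I` small. If `Ibar` is universal
over `S` in `I`, then `E(Ibar)` is universal over `M₀`: a competitor `N` lands in some `E(T)`, the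
two maps from `M₀` agree in `E(U)` for a small `U` above `S` and `T`, and `U` maps to `Ibar` under
`S`. For the range of cardinals, `|I| ≤ σ` forces `|E(I)| ≤ σ` above the threshold. -/

namespace EM

namespace Lin

/-- The underlying order embedding of a morphism of linear orders. -/
def toEmb {I J : Lin.{w}} (f : I ⟶ J) : I.carrier ↪o J.carrier := f

lemma toEmb_comp {I J L : Lin.{w}} (f : I ⟶ J) (g : J ⟶ L) (x : I.carrier) :
    toEmb (f ≫ g) x = toEmb g (toEmb f x) := rfl

lemma toEmb_id (I : Lin.{w}) (x : I.carrier) : toEmb (𝟙 I) x = x := rfl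

lemma hom_ext {I J : Lin.{w}} {f g : I ⟶ J} (h : ∀ x, toEmb f x = toEmb g x) : f = g :=
  DFunLike.ext (F := I.carrier ↪o J.carrier) f g h

/-- Isomorphic linear orders are isomorphic in `Lin`. -/
def isoOfOrderIso {I J : Lin.{w}} (e : I.carrier ≃o J.carrier) : I ≅ J where
  hom := e.toOrderEmbedding
  inv := e.symm.toOrderEmbedding
  hom_inv_id := hom_ext e.symm_apply_apply
  inv_hom_id := hom_ext e.apply_symm_apply

/-- A subset of a linear order, as an object of `Lin`. -/
abbrev ofSet (I : Lin.{w}) (S : Set I.carrier) : Lin.{w} := ⟨S⟩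

/-- The inclusion of a subset. -/
def incl (I : Lin.{w}) (S : Set I.carrier) : I.ofSet S ⟶ I := OrderEmbedding.subtype (· ∈ S)

/-- Corestriction of a morphism to a subset containing its range. -/
def lift {I J : Lin.{w}} (S : Set J.carrier) (f : I ⟶ J) (h : ∀ x, toEmb f x ∈ S) :
    I ⟶ J.ofSet S :=
  OrderEmbedding.ofMapLEIff (fun x ↦ (⟨toEmb f x, h x⟩ : S)) fun _ _ ↦ (toEmb f).le_iff_le

lemma lift_incl {I J : Lin.{w}} (S : Set J.carrier) (f : I ⟶ J) (h : ∀ x, toEmb f x ∈ S) :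
    lift S f h ≫ J.incl S = f := rfl

instance mono {I J : Lin.{w}} (f : I ⟶ J) : Mono f where
  right_cancellation g h e := hom_ext fun x ↦ (toEmb f).injective (by
    rw [← toEmb_comp, ← toEmb_comp, e])

section Colimits

variable {A : Type w} [SmallCategory A] {F : A ⥤ Lin.{w}}

lemma toEmb_w (c : Cocone F) {i j : A} (f : i ⟶ j) (x : (F.obj i).carrier) :
    toEmb (c.ι.app j) (toEmb (F.map f) x) = toEmb (c.ι.app i) x := by
  rw [← toEmb_comp, c.w]

/-- The points reached by the legs form a subset through which the cocone factors; descending to it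
and including back is the identity, so the subset is everything. -/
lemma exists_rep_of_isColimit {c : Cocone F} (hc : IsColimit c) (x : c.pt.carrier) :
    ∃ (j : A) (y : (F.obj j).carrier), toEmb (c.ι.app j) y = x := by
  let S : Set c.pt.carrier := {x | ∃ (j : A) (y : (F.obj j).carrier), toEmb (c.ι.app j) y = x}
  let s : Cocone F :=
    { pt := c.pt.ofSet S
      ι :=
        { app j := lift S (c.ι.app j) fun y ↦ ⟨j, y, rfl⟩
          naturality i j f := by
            rw [← cancel_mono (c.pt.incl S), Category.assoc, Category.assoc, lift_incl]
            exact c.ι.naturality f } }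
  have h : hc.desc s ≫ c.pt.incl S = 𝟙 c.pt := by
    refine hc.hom_ext fun j ↦ ?_
    rw [hc.fac_assoc, Category.comp_id]
    rfl
  have hx : toEmb (c.pt.incl S) (toEmb (hc.desc s) x) = x := by
    rw [← toEmb_comp, h, toEmb_id]
  rw [← hx]
  exact (toEmb (hc.desc s) x).2

/-- The legs of `c` are injective, so the two points already agree at a common later stage. -/
lemma cocone_eq_of_eq [IsFilteredOrEmpty A] (c s : Cocone F) {i j : A} (x : (F.obj i).carrier)
    (y : (F.obj j).carrier) (h : toEmb (c.ι.app i) x = toEmb (c.ι.app j) y) :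
    toEmb (s.ι.app i) x = toEmb (s.ι.app j) y := by
  rw [← toEmb_w c (IsFiltered.leftToMax i j), ← toEmb_w c (IsFiltered.rightToMax i j)] at h
  rw [← toEmb_w s (IsFiltered.leftToMax i j), ← toEmb_w s (IsFiltered.rightToMax i j),
    (toEmb (c.ι.app _)).injective h]

/-- A jointly surjective cocone over a filtered diagram of linear orders is a colimit. -/
noncomputable def isColimitOfJointlySurjective [IsFilteredOrEmpty A] (c : Cocone F)
    (hc : ∀ x : c.pt.carrier, ∃ (j : A) (y : (F.obj j).carrier), toEmb (c.ι.app j) y = x) :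
    IsColimit c := by
  choose a y hy using hc
  have key (s : Cocone F) (j : A) (z : (F.obj j).carrier) :
      toEmb (s.ι.app (a (toEmb (c.ι.app j) z))) (y (toEmb (c.ι.app j) z)) =
        toEmb (s.ι.app j) z :=
    cocone_eq_of_eq c s _ _ (hy _)
  exact
    { desc s := OrderEmbedding.ofMapLEIff (fun x ↦ toEmb (s.ι.app (a x)) (y x)) fun x x' ↦ by
        let l := IsFiltered.leftToMax (a x) (a x')
        let r := IsFiltered.rightToMax (a x) (a x')
        conv_rhs => rw [← hy x, ← hy x', ← toEmb_w c l, ← toEmb_w c r]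
        rw [← toEmb_w s l, ← toEmb_w s r, OrderEmbedding.le_iff_le, OrderEmbedding.le_iff_le]
      fac s j := hom_ext (key s j)
      uniq s m hm := hom_ext fun x ↦ by
        conv_lhs => rw [← hy x]
        rw [← toEmb_comp, hm]
        rfl }

end Colimits

section SmallSubsets

variable (I : Lin.{w}) (μ : Cardinal.{w})

/-- The diagram of the subsets of `I` of cardinality less than `μ`. -/
def subsetFunctor : HasCardinalLT.Set I.carrier μ ⥤ Lin.{w} where
  obj S := I.ofSet S.1
  map {S T} f := lift T.1 (I.incl S.1) fun x ↦ leOfHom f x.2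

/-- `I` as a cocone over its subsets of cardinality less than `μ`. -/
def subsetCocone : Cocone (I.subsetFunctor μ) where
  pt := I
  ι := { app S := I.incl S.1 }

/-- `I` is the colimit of its subsets of cardinality less than `μ`. -/
noncomputable def isColimitSubsetCocone [Fact μ.IsRegular] :
    IsColimit (I.subsetCocone μ) :=
  isColimitOfJointlySurjective _ fun (x : I.carrier) ↦
    ⟨⟨{x}, hasCardinalLT_of_finite _ _ (Cardinal.IsRegular.aleph0_le Fact.out)⟩, ⟨x, rfl⟩, rfl⟩

end SmallSubsets

lemma isCardinalPresentable_of_hasCardinalLT {I : Lin.{w}} {μ : Cardinal.{w}} [Fact μ.IsRegular]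
    (hI : HasCardinalLT I.carrier μ) : IsCardinalPresentable I μ where
  preservesColimitOfShape A _ _ :=
    ⟨fun {F} ↦ ⟨fun {c} hc ↦ ⟨by
      have := isFiltered_of_isCardinalFiltered A μ
      refine Types.FilteredColimit.isColimitOf' _ _ (fun (f : I ⟶ c.pt) ↦ ?_)
        (fun j (f g : I ⟶ F.obj j) h ↦ ?_)
      -- Fewer than `μ` representatives fit into one stage `m`; the leg at `m` reflects the order,
      -- so they form an embedding.
      · choose j y hy using fun x ↦ exists_rep_of_isColimit hc (toEmb f x)
        let m := IsCardinalFiltered.max j hI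
        let z (x : I.carrier) : (F.obj m).carrier :=
          toEmb (F.map (IsCardinalFiltered.toMax j hI x)) (y x)
        have hz (x) : toEmb (c.ι.app m) (z x) = toEmb f x := by rw [toEmb_w, hy]
        let g : I ⟶ F.obj m := OrderEmbedding.ofMapLEIff z fun x x' ↦ by
          rw [← (toEmb (c.ι.app m)).le_iff_le, hz, hz, (toEmb f).le_iff_le]
        exact ⟨m, g, hom_ext fun x ↦ (hz x).symm⟩
      · have h' : f ≫ c.ι.app j = g ≫ c.ι.app j := h
        rw [cancel_mono] at h'
        exact ⟨j, 𝟙 j, by rw [h']⟩⟩⟩⟩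

/-- The identity of `I` factors through a small subset. -/
lemma hasCardinalLT_of_isCardinalPresentable {I : Lin.{w}} {μ : Cardinal.{w}} [Fact μ.IsRegular]
    [IsCardinalPresentable I μ] : HasCardinalLT I.carrier μ := by
  obtain ⟨S, f, hf⟩ := IsCardinalPresentable.exists_hom_of_isColimit μ
    (I.isColimitSubsetCocone μ) (𝟙 I)
  exact S.2.of_injective (toEmb f) (toEmb f).injective

lemma presentable_iff {I : Lin.{w}} {μ : Cardinal.{w}} (hμ : μ.IsRegular) :
    Presentable μ I ↔ HasCardinalLT I.carrier μ := by
  have : Fact μ.IsRegular := ⟨hμ⟩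
  exact ⟨fun ⟨_, _⟩ ↦ hasCardinalLT_of_isCardinalPresentable,
    fun h ↦ ⟨hμ, isCardinalPresentable_of_hasCardinalLT h⟩⟩

end Lin

/-! ### Presentability ranks and EM-functors -/

section

variable {C : Type u} [Category.{v} C]

lemma Presentable.mono {μ ν : Cardinal.{w}} {X : C} (h : Presentable μ X) (hν : ν.IsRegular)
    (hle : μ ≤ ν) : Presentable ν X := by
  obtain ⟨hμ, _⟩ := h
  have : Fact μ.IsRegular := ⟨hμ⟩
  have : Fact ν.IsRegular := ⟨hν⟩
  exact ⟨hν, isCardinalPresentable_of_le X hle⟩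

lemma size_le {σ : Cardinal.{w}} (hσ : Cardinal.aleph0 ≤ σ) {X : C}
    (h : Presentable (Order.succ σ) X) : size.{w} X ≤ σ :=
  csInf_le' ⟨hσ, h⟩

lemma presentable_succ_size (I : Lin.{w}) : Presentable (Order.succ (size.{w} I)) I := by
  have hne : {lam : Cardinal.{w} |
      Cardinal.aleph0 ≤ lam ∧ Presentable (Order.succ lam) I}.Nonempty := by
    refine ⟨max Cardinal.aleph0 (Cardinal.mk I.carrier), le_max_left _ _, ?_⟩
    rw [Lin.presentable_iff (Cardinal.isRegular_succ (le_max_left _ _)),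
      hasCardinalLT_iff_cardinal_mk_lt, Order.lt_succ_iff]
    exact le_max_right _ _
  exact (csInf_mem hne).2

lemma hasCardinalLT_finiteSubsets {X : Type w} {μ : Cardinal.{w}} (hμ : Cardinal.aleph0 ≤ μ)
    (hX : HasCardinalLT X μ) : HasCardinalLT (HasCardinalLT.Set X Cardinal.aleph0.{w}) μ := by
  have h : HasCardinalLT (Finset X) μ := by
    cases finite_or_infinite X
    · exact hasCardinalLT_of_finite _ _ hμ
    · rwa [hasCardinalLT_iff_cardinal_mk_lt, Cardinal.mk_finset_of_infinite,
        ← hasCardinalLT_iff_cardinal_mk_lt]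
  refine h.of_surjective (fun s ↦ ⟨s, hasCardinalLT_of_finite _ _ le_rfl⟩) fun S ↦ ?_
  have hS : S.1.Finite := (hasCardinalLT_aleph0_iff _).1 S.2
  exact ⟨hS.toFinset, Subtype.ext hS.coe_toFinset⟩

lemma hasCardinalLT_arrow_of_preorder {X : Type w} [Preorder X] {μ : Cardinal.{w}}
    (hμ : Cardinal.aleph0 ≤ μ) (hX : HasCardinalLT X μ) : HasCardinalLT (Arrow X) μ := by
  refine (hasCardinalLT_prod hμ hX hX).of_injective (fun f ↦ (f.left, f.right)) ?_
  rintro ⟨a, b, f⟩ ⟨a', b', f'⟩ h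
  obtain ⟨rfl, rfl⟩ := Prod.mk.inj h
  obtain rfl : f = f' := Subsingleton.elim _ _
  rfl

lemma exists_isRegular_forall_presentable [IsAccessibleCategory.{w} C] (X : ℕ → C) :
    ∃ κ : Cardinal.{w}, κ.IsRegular ∧ ∀ n, Presentable κ (X n) := by
  have h (n : ℕ) : ∃ κ : Cardinal.{w}, Presentable κ (X n) := by
    obtain ⟨κ, hκ, h⟩ := (inferInstance : IsPresentable.{w} (X n)).exists_cardinal
    exact ⟨κ, hκ.out, h⟩
  choose κ hκ using h
  have hle (n : ℕ) : κ n ≤ Order.succ (max Cardinal.aleph0 (⨆ n, κ n)) :=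
    ((le_ciSup (Cardinal.bddAbove_of_small) n).trans (le_max_right _ _)).trans (Order.le_succ _)
  have hreg := Cardinal.isRegular_succ (le_max_left Cardinal.aleph0.{w} (⨆ n, κ n))
  exact ⟨_, hreg, fun n ↦ (hκ n).mono hreg (hle n)⟩

/-- The linear order with `n` elements. -/
abbrev Lin.fin (n : ℕ) : Lin.{w} := ⟨ULift.{w} (Fin n)⟩

lemma Lin.exists_iso_fin (I : Lin.{w}) [Finite I.carrier] : ∃ n, Nonempty (Lin.fin.{w} n ≅ I) := by
  have := Fintype.ofFinite I.carrier
  exact ⟨_, ⟨isoOfOrderIso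
    (ULift.orderIso.{w}.trans (Fintype.orderIsoFinOfCardEq I.carrier rfl))⟩⟩

lemma IsEMFunctor.isColimitMap {E : Lin.{w} ⥤ C} (hE : IsEMFunctor E) (I : Lin.{w})
    (μ : Cardinal.{w}) (hμ : μ.IsRegular) :
    Nonempty (IsColimit (E.mapCocone (I.subsetCocone μ))) := by
  have : Fact μ.IsRegular := ⟨hμ⟩
  have := hE.preserves.preserves_filtered_colimits (HasCardinalLT.Set I.carrier μ)
  exact ⟨isColimitOfPreserves E (I.isColimitSubsetCocone μ)⟩

/-- An EM-functor into an accessible category preserves presentability from its threshold on. -/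
lemma IsEMFunctor.presentable_obj [IsAccessibleCategory.{w} C] {E : Lin.{w} ⥤ C}
    (hE : IsEMFunctor E) {μ : Cardinal.{w}} (hμ : μ.IsRegular) (hle : threshold E ≤ μ)
    {I : Lin.{w}} (hI : Presentable μ I) : Presentable μ (E.obj I) := by
  -- An infimum of cardinals is attained once the set is nonempty. A bound for the ranks of the
  -- images of finite orders works, since `E(I)` is a colimit of these over fewer than `μ` arrows.
  have hne : {κ : Cardinal.{w} | Cardinal.aleph0 ≤ κ ∧ ∀ μ : Cardinal.{w}, μ.IsRegular → κ ≤ μ →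
      ∀ I : Lin.{w}, Presentable μ I → Presentable μ (E.obj I)}.Nonempty := by
    obtain ⟨κ, hκ, hfin⟩ := exists_isRegular_forall_presentable fun n ↦ E.obj (Lin.fin.{w} n)
    refine ⟨κ, hκ.aleph0_le, fun μ hμ hle I hI ↦ ⟨hμ, ?_⟩⟩
    have : Fact μ.IsRegular := ⟨hμ⟩
    obtain ⟨hc⟩ := hE.isColimitMap I Cardinal.aleph0 Cardinal.isRegular_aleph0
    have (S : HasCardinalLT.Set I.carrier Cardinal.aleph0.{w}) :
        IsCardinalPresentable ((I.subsetFunctor _ ⋙ E).obj S) μ := by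
      have : Finite (I.ofSet S.1).carrier := (hasCardinalLT_aleph0_iff _).1 S.2
      obtain ⟨n, ⟨e⟩⟩ := (I.ofSet S.1).exists_iso_fin
      obtain ⟨_, _⟩ := (hfin n).mono hμ hle
      exact isCardinalPresentable_of_iso (E.mapIso e) μ
    obtain ⟨_, _, _⟩ := IsAccessibleCategory.exists_cardinal.{w} C
    exact isCardinalPresentable_of_isColimit _ hc μ
      (hasCardinalLT_arrow_of_preorder hμ.aleph0_le
        (hasCardinalLT_finiteSubsets hμ.aleph0_le ((Lin.presentable_iff hμ).1 hI)))
  exact (csInf_mem hne).2 μ hμ hle I hI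

lemma IsEMFunctor.exists_factorization {E : Lin.{w} ⥤ C} (hE : IsEMFunctor E)
    {μ : Cardinal.{w}} {X : C} (hX : Presentable μ X) {I : Lin.{w}} (f : X ⟶ E.obj I) :
    ∃ (S : Set I.carrier) (f' : X ⟶ E.obj (I.ofSet S)),
      HasCardinalLT S μ ∧ f' ≫ E.map (I.incl S) = f := by
  obtain ⟨hμ, _⟩ := hX
  have : Fact μ.IsRegular := ⟨hμ⟩
  obtain ⟨hc⟩ := hE.isColimitMap I μ hμ
  obtain ⟨S, f', hf'⟩ := IsCardinalPresentable.exists_hom_of_isColimit μ hc f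
  exact ⟨S.1, f', S.2, hf'⟩

lemma IsEMFunctor.exists_map_eq {E : Lin.{w} ⥤ C} (hE : IsEMFunctor E) {μ : Cardinal.{w}}
    {X : C} (hX : Presentable μ X) {I : Lin.{w}} {S T : Set I.carrier} (hS : HasCardinalLT S μ)
    (hT : HasCardinalLT T μ) (f : X ⟶ E.obj (I.ofSet S)) (g : X ⟶ E.obj (I.ofSet T))
    (h : f ≫ E.map (I.incl S) = g ≫ E.map (I.incl T)) :
    ∃ (U : Set I.carrier) (s : I.ofSet S ⟶ I.ofSet U) (t : I.ofSet T ⟶ I.ofSet U),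
      HasCardinalLT U μ ∧ s ≫ I.incl U = I.incl S ∧ f ≫ E.map s = g ≫ E.map t := by
  obtain ⟨hμ, _⟩ := hX
  have : Fact μ.IsRegular := ⟨hμ⟩
  obtain ⟨hc⟩ := hE.isColimitMap I μ hμ
  obtain ⟨U, s, t, hst⟩ := IsCardinalPresentable.exists_eq_of_isColimit μ hc
    (i₁ := ⟨S, hS⟩) (i₂ := ⟨T, hT⟩) f g h
  exact ⟨U.1, (I.subsetFunctor μ).map s, (I.subsetFunctor μ).map t, U.2,
    (I.subsetCocone μ).w s, hst⟩

/-- EM-functors preserve brimfulness at regular cardinals above the threshold. -/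
lemma IsEMFunctor.isBrimfulAt_obj [IsAccessibleCategory.{w} C] {E : Lin.{w} ⥤ C}
    (hE : IsEMFunctor E) {μ : Cardinal.{w}} (hμ : μ.IsRegular) (hle : threshold E ≤ μ)
    {I : Lin.{w}} (hI : IsBrimfulAt μ I) : IsBrimfulAt μ (E.obj I) := by
  intro M₀ f hM₀
  obtain ⟨S, f₀, hS, rfl⟩ := hE.exists_factorization hM₀ f
  obtain ⟨Ibar, g₁, g₂, hIbar, hg, huniv⟩ := hI _ (I.incl S) ((Lin.presentable_iff hμ).2 hS)
  refine ⟨E.obj Ibar, f₀ ≫ E.map g₁, E.map g₂, hE.presentable_obj hμ hle hIbar, ?_, ?_⟩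
  · rw [Category.assoc, ← E.map_comp, hg]
  intro N b₁ b₂ hN hb
  rw [Category.assoc, ← E.map_comp, hg] at hb
  obtain ⟨T, n, hT, rfl⟩ := hE.exists_factorization hN b₂
  obtain ⟨U, s, t, hU, hs, hst⟩ := hE.exists_map_eq hM₀ hS hT f₀ (b₁ ≫ n)
    (by rw [Category.assoc, hb])
  -- The competitor for universality is `U`, which replaces `g₁` by `s ≫ g`.
  obtain ⟨g, rfl⟩ := huniv _ s (I.incl U) ((Lin.presentable_iff hμ).2 hU) (hs.trans hg.symm)
  refine ⟨n ≫ E.map t ≫ E.map g, ?_⟩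
  rw [E.map_comp, reassoc_of% hst]

end

end EM

theorem proposition7p7 {K : Type u} [Category.{v} K] [IsAccessibleCategory.{w} K]
    [HasFilteredColimitsOfSize.{w, w} K] (E : EM.Lin.{w} ⥤ K) (hE : EM.IsEMFunctor E)
    (I : EM.Lin.{w}) :
    (EM.IsBrimful.{w} I → EM.IsBrimfulFrom.{w} (EM.threshold E) (E.obj I)) ∧
      ∀ μ : Cardinal.{w}, μ.IsRegular → EM.threshold E ≤ μ →
        EM.IsBrimfulAt μ I → EM.IsBrimfulAt μ (E.obj I) := by

  refine ⟨fun hI σ hσ hle hsize ↦ ?_, fun μ hμ hle hI ↦ hE.isBrimfulAt_obj hμ hle hI⟩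
  have hreg := Cardinal.isRegular_succ hσ
  refine hE.isBrimfulAt_obj hreg hle (hI σ hσ (hσ.trans (Order.le_succ σ)) ?_)
  -- Otherwise `I`, hence `E(I)`, is `σ⁺`-presentable, and `|E(I)| ≤ σ`.
  by_contra! hlt
  have hI' : EM.Presentable (Order.succ σ) I :=
    (EM.presentable_succ_size I).mono hreg (Order.succ_le_succ (Order.lt_succ_iff.1 hlt))
  exact ((Order.lt_succ σ).trans_le hsize).not_ge
    (EM.size_le hσ (hE.presentable_obj hreg hle hI'))
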